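/- Let $p>2$ be a prime, let $F$ be an algebraically closed field of characteristic $p$, and let $s\ge 1$ be an integer. Put $m=sp-1$ and let $\mathcal X$ be the nonsingular projective curve over $F$ with affine equation $y^2=x^m+1$, i.e. the nonsingular projective curve whose function field is $F(x,y)$ with $x$ transcendental over $F$ and $y^2=x^m+1$. The $a$-number $a(\mathcal X)$ is the dimension over $F$ of the space of exact holomorphic differentials on $\mathcal X$, i.e. of the (finite-dimensional) space of those differentials $\omega\in H^0(\mathcal X,\Omega^1)$ that have the form $\omega=dh$ for some $h$ in the function field of $\mathcal X$. Then: 1. if $s=2k+1$ with $k\ge 0$, then $a(\mathcal X)=\dfrac{k(p-1)}{2}$; 2. if $s=2k$ with $k\ge 1$, then $a(\mathcal X)=\dfrac{k(p-1)}{2}$. -/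

import Mathlib

/-- `K` is the function field of the (nonsingular projective model of the) curve with affine
equation `y ^ 2 = f(x)` over `F`, with coordinate functions `x` and `y`: the element `x` is
transcendental over `F`, the equation holds, and `K = F(x, y)`. When `f` is not a square
in `F(x)`, this determines `(K, x, y)` up to a unique isomorphism over `F`. -/
structure IsFunctionFieldOfSqEq (F K : Type*) [Field F] [Field K] [Algebra F K]
    (f : Polynomial F) (x y : K) : Prop where
  transcendental : Transcendental F x
  equation : y ^ 2 = Polynomial.aeval x f
  adjoin_eq_top : IntermediateField.adjoin F {x, y} = ⊤

/-- The differential `ω` of `K / F` is regular at the valuation ring `O` of `K`: it lies in the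
image of the differentials of `O`, that is, it is a finite sum of `a • d b` with `a, b ∈ O`.
If `O` is the local ring of a point of a nonsingular curve with local parameter `t`, this says
`ω ∈ O • d t`, i.e. that `ω` has no pole at the point. -/
def IsRegularDifferentialAt (F : Type*) {K : Type*} [Field F] [Field K] [Algebra F K]
    (O : ValuationSubring K) (ω : KaehlerDifferential F K) : Prop :=
  ω ∈ Submodule.span O.toSubring (KaehlerDifferential.D F K '' (O : Set K))

/-- The space `H⁰(X, Ω¹)` of holomorphic differentials of the nonsingular projective curve `X`
over `F` with function field `K`: the differentials of `K / F` that are regular at every point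
of `X`. The points of `X` are the valuation rings of `K` that contain `F`; the trivial valuation
ring `K` (the generic point) imposes no condition. -/
noncomputable def holomorphicDifferentials (F K : Type*) [Field F] [Field K] [Algebra F K] :
    Submodule F (KaehlerDifferential F K) where
  carrier := {ω | ∀ O : ValuationSubring K, (∀ c : F, algebraMap F K c ∈ O) →
    IsRegularDifferentialAt F O ω}
  zero_mem' := fun _ _ => Submodule.zero_mem _
  add_mem' := fun h₁ h₂ O hO => Submodule.add_mem _ (h₁ O hO) (h₂ O hO)
  smul_mem' := fun c ω h O hO => by
    have key := Submodule.smul_mem _ (⟨algebraMap F K c, hO c⟩ : O.toSubring) (h O hO)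
    have e : (⟨algebraMap F K c, hO c⟩ : O.toSubring) • ω = c • ω :=
      algebraMap_smul K c ω
    rw [e] at key
    exact key

/-- The space of exact differentials of `K / F`: those of the form `d h` with `h ∈ K`. -/
noncomputable def exactDifferentials (F K : Type*) [Field F] [Field K] [Algebra F K] :
    Submodule F (KaehlerDifferential F K) :=
  LinearMap.range (KaehlerDifferential.D F K).toLinearMap

/-- The space of exact holomorphic differentials of the nonsingular projective curve over `F`
with function field `K`. -/
noncomputable def exactHolomorphicDifferentials (F K : Type*) [Field F] [Field K] [Algebra F K] :
    Submodule F (KaehlerDifferential F K) :=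
  holomorphicDifferentials F K ⊓ exactDifferentials F K

/-- The `a`-number of the nonsingular projective curve over `F` with function field `K`: the
dimension of its space of exact holomorphic differentials. -/
noncomputable def aNumber (F K : Type*) [Field F] [Field K] [Algebra F K] : ℕ :=
  Module.finrank F (exactHolomorphicDifferentials F K)

/-! Write h = x^m + 1, p = 2r + 1, and 2g + 2 = m or m + 1, whichever is even. Two charts with
coordinates (x, y) and (1/x, y/x^(g+1)) cover the curve. Both equations are v^2 = (separable
polynomial in u), and on such a chart the regular differentials are the regular functions times
du/v. Gluing shows that the holomorphic differentials are a(x) dx/y with deg a < g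
(`smul_mem_holomorphicDifferentials_iff`).

For exactness, 1/y = y^(-p) h^r and y^p is a constant for d, so a dx/y is exact iff a h^r dx is.
This holds iff a h^r has no term of exponent congruent to -1 mod p
(`smul_mem_exactDifferentials_iff`). Since m is -1 mod p, the term x^i x^(mj) of x^i h^r has such an
exponent iff j is i + 1 mod p. As j runs over 0, ..., r, exactness of x^i dx/y means (i + 1) mod p >
r. Terms from different i < m never collide, so these monomials span all exact holomorphic
differentials. Counting gives r indices in each of k full periods and none in the remainder. -/

open Polynomial

/-! ### Quadratic extensions of F(X): integral elements and separability. -/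

section DoubleCover

variable {F L K : Type*} [Field F] [Field L] [Field K]
  [Algebra F[X] K] [Algebra F[X] L] [Algebra L K] [IsScalarTower F[X] L K]

theorem minpoly_of_sq_eq {h : F[X]} {v : K} (hv : v ^ 2 = algebraMap F[X] K h)
    (hnot : v ∉ (algebraMap L K).range) :
    minpoly L v = X ^ 2 - C (algebraMap F[X] L h) := by
  symm
  have hmon : (X ^ 2 - C (algebraMap F[X] L h)).Monic := monic_X_pow_sub_C _ two_ne_zero
  apply minpoly.unique _ _ hmon
  · simp [hv, ← IsScalarTower.algebraMap_apply]
  · intro q hq hq0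
    have hint : IsIntegral L v := ⟨q, hq, hq0⟩
    rw [degree_X_pow_sub_C two_pos]
    refine le_trans ?_ (minpoly.min L v hq hq0)
    rw [degree_eq_natDegree (minpoly.ne_zero hint)]
    exact_mod_cast (minpoly.two_le_natDegree_iff hint).2 hnot

variable {h : F[X]} {v : K}

theorem isIntegral_of_sq_eq (hv : v ^ 2 = algebraMap F[X] K h) : IsIntegral F[X] v :=
  IsIntegral.of_pow (n := 2) two_pos (hv ▸ isIntegral_algebraMap)

theorem finiteDimensional_of_sq_eq (hv : v ^ 2 = algebraMap F[X] K h)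
    (htop : IntermediateField.adjoin L {v} = ⊤) : FiniteDimensional L K := by
  have := IntermediateField.adjoin.finiteDimensional
    ((isIntegral_of_sq_eq hv).tower_top (A := L))
  rw [htop] at this
  exact Module.Finite.equiv (IntermediateField.topEquiv (F := L) (E := K)).toLinearEquiv

theorem exists_eq_add_mul_of_sq_eq (hv : v ^ 2 = algebraMap F[X] K h)
    (htop : IntermediateField.adjoin L {v} = ⊤) (w : K) :
    ∃ a b : L, w = algebraMap L K a + algebraMap L K b * v := by
  have hint := (isIntegral_of_sq_eq hv).tower_top (A := L)
  have hw : w ∈ Algebra.adjoin L {v} := by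
    rw [← IntermediateField.adjoin_simple_toSubalgebra_of_isAlgebraic hint.isAlgebraic, htop]
    trivial
  induction hw using Algebra.adjoin_induction with
  | mem x hx => exact ⟨0, 1, by simp_all⟩
  | algebraMap r => exact ⟨r, 0, by simp⟩
  | add x y _ _ hx hy =>
    obtain ⟨a, b, rfl⟩ := hx
    obtain ⟨c, d, rfl⟩ := hy
    exact ⟨a + c, b + d, by simp only [map_add]; ring⟩
  | mul x y _ _ hx hy =>
    obtain ⟨a, b, rfl⟩ := hx
    obtain ⟨c, d, rfl⟩ := hy
    refine ⟨a * c + b * d * algebraMap F[X] L h, a * d + b * c, ?_⟩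
    simp only [map_add, map_mul, ← IsScalarTower.algebraMap_apply, ← hv]
    ring

theorem algebraMap_C_two : algebraMap F[X] L (C 2) = 2 := by
  have h : (C (2 : F)) = ((2 : ℕ) : F[X]) := by
    rw [← map_natCast C]; norm_num
  rw [h, map_natCast]; norm_num

theorem trace_add_mul_of_sq_eq (hv : v ^ 2 = algebraMap F[X] K h)
    (hnot : v ∉ (algebraMap L K).range)
    (htop : IntermediateField.adjoin L {v} = ⊤) (a b : L) :
    Algebra.trace L K (algebraMap L K a + algebraMap L K b * v) = 2 * a := by
  have := finiteDimensional_of_sq_eq (L := L) hv htop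
  have hint := (isIntegral_of_sq_eq hv).tower_top (A := L)
  have hmin := minpoly_of_sq_eq hv hnot
  have hfin : Module.finrank L K = 2 := by
    rw [← IntermediateField.finrank_top', ← htop, IntermediateField.adjoin.finrank hint, hmin,
      natDegree_X_pow_sub_C]
  have htr : Algebra.trace L K v = 0 := by
    rw [trace_eq_finrank_mul_minpoly_nextCoeff, hmin, nextCoeff_of_natDegree_pos (by simp)]
    simp
  rw [map_add, Algebra.trace_algebraMap, hfin, ← Algebra.smul_def, map_smul, htr]
  simp

variable [IsFractionRing F[X] L]

/-- A field element whose square is a nonconstant squarefree polynomial is not rational. -/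
theorem notMem_range_of_sq_eq_squarefree (hsq : Squarefree h)
    (hdeg : 0 < h.natDegree) (hv : v ^ 2 = algebraMap F[X] K h) :
    v ∉ (algebraMap L K).range := by
  rintro ⟨c, rfl⟩
  have hc : c ^ 2 = algebraMap F[X] L h := by
    apply (algebraMap L K).injective
    rw [map_pow, hv, ← IsScalarTower.algebraMap_apply]
  have hint : IsIntegral F[X] c :=
    IsIntegral.of_pow (n := 2) two_pos (hc ▸ isIntegral_algebraMap)
  obtain ⟨q, rfl⟩ := IsIntegrallyClosed.isIntegral_iff.1 hint
  have hq : q ^ 2 = h := by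
    apply IsFractionRing.injective F[X] L
    rw [map_pow, hc]
  have hu : IsUnit q := hsq q ⟨1, by rw [← hq]; ring⟩
  have : IsUnit h := hq ▸ hu.pow 2
  rw [natDegree_eq_zero_of_isUnit this] at hdeg
  exact lt_irrefl _ hdeg

theorem isSeparable_of_sq_eq (h2 : (2 : F) ≠ 0) (h0 : h ≠ 0)
    (hv : v ^ 2 = algebraMap F[X] K h)
    (hnot : v ∉ (algebraMap L K).range)
    (htop : IntermediateField.adjoin L {v} = ⊤) : Algebra.IsSeparable L K := by
  have h2L : ((2 : ℕ) : L) ≠ 0 := by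
    have := (map_ne_zero_iff _ (IsFractionRing.injective F[X] L)).2 (C_ne_zero.2 h2)
    simpa [algebraMap_C_two] using this
  have hs : IsSeparable L v := by
    rw [IsSeparable, minpoly_of_sq_eq hv hnot]
    exact separable_X_pow_sub_C _ h2L
      ((map_ne_zero_iff _ (IsFractionRing.injective F[X] L)).2 h0)
  have := IntermediateField.isSeparable_adjoin_simple_iff_isSeparable L K |>.2 hs
  rw [htop] at this
  exact Algebra.IsSeparable.of_algHom _ _
    (IntermediateField.topEquiv (F := L) (E := K)).symm.toAlgHom

/-- The trace 2a of a + bv is integral over the integrally closed ring F[X], so a is a polynomial.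
Applied to wv and (bv)^2, the same argument makes c = bh and e = b^2 h polynomials. Then c^2 = he,
and squarefreeness gives h ∣ c, so b is a polynomial. -/
theorem exists_eq_add_mul_of_isIntegral (h2 : (2 : F) ≠ 0) (hsq : Squarefree h)
    (hv : v ^ 2 = algebraMap F[X] K h)
    (hnot : v ∉ (algebraMap L K).range)
    (htop : IntermediateField.adjoin L {v} = ⊤) {w : K} (hw : IsIntegral F[X] w) :
    ∃ a b : F[X], w = algebraMap F[X] K a + algebraMap F[X] K b * v := by
  have := finiteDimensional_of_sq_eq (L := L) hv htop
  have h0 : h ≠ 0 := hsq.ne_zero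
  have hinj := IsFractionRing.injective F[X] L
  have key : ∀ (a b : L) (t : K), t = algebraMap L K a + algebraMap L K b * v →
      IsIntegral F[X] t → ∃ q : F[X], a = algebraMap F[X] L q := by
    rintro a b _ rfl hab
    have h1 := Algebra.isIntegral_trace (L := L) hab
    rw [trace_add_mul_of_sq_eq hv hnot htop] at h1
    obtain ⟨q, hq⟩ := IsIntegrallyClosed.isIntegral_iff.1 h1
    refine ⟨C (2⁻¹) * q, ?_⟩
    rw [map_mul, hq, ← mul_assoc]
    have : algebraMap F[X] L (C 2⁻¹) * 2 = 1 := by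
      have h3 : algebraMap F[X] L (C 2⁻¹ * C 2) = 1 := by
        rw [← C_mul, inv_mul_cancel₀ h2]; simp
      rwa [map_mul, algebraMap_C_two] at h3
    rw [this, one_mul]
  obtain ⟨a, b, rfl⟩ := exists_eq_add_mul_of_sq_eq (L := L) hv htop w
  obtain ⟨q, rfl⟩ := key a b _ rfl hw
  have hbh : ∃ c : F[X], b * algebraMap F[X] L h = algebraMap F[X] L c := by
    refine key _ (algebraMap F[X] L q) _ ?_ (hw.mul (isIntegral_of_sq_eq hv))
    simp only [map_mul, ← IsScalarTower.algebraMap_apply, ← hv]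
    ring
  obtain ⟨c, hc⟩ := hbh
  have hbv : IsIntegral F[X] (algebraMap L K b * v) := by
    have := hw.sub (isIntegral_algebraMap (x := q))
    rwa [IsScalarTower.algebraMap_apply F[X] L K, add_sub_cancel_left] at this
  obtain ⟨e, he⟩ := key (b ^ 2 * algebraMap F[X] L h) 0 _ (by
    simp only [map_mul, map_pow, map_zero, ← IsScalarTower.algebraMap_apply, ← hv]
    ring) (hbv.pow 2)
  have hce : c ^ 2 = h * e := by
    apply hinj
    rw [map_pow, ← hc, map_mul, ← he]
    ring
  obtain ⟨d, rfl⟩ : h ∣ c := (hsq.dvd_pow_iff_dvd two_ne_zero).1 ⟨e, hce⟩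
  refine ⟨q, d, ?_⟩
  have : b = algebraMap F[X] L d := by
    rw [map_mul, mul_comm] at hc
    exact mul_left_cancel₀ ((map_ne_zero_iff _ hinj).2 h0) hc
  rw [this, ← IsScalarTower.algebraMap_apply, ← IsScalarTower.algebraMap_apply]

/-- A localization followed by a finite separable extension. It makes the differentials of K free of
rank one on the differential of X. -/
theorem formallyEtale_of_sq_eq (h2 : (2 : F) ≠ 0) (h0 : h ≠ 0)
    (hv : v ^ 2 = algebraMap F[X] K h)
    (hnot : v ∉ (algebraMap L K).range)
    (htop : IntermediateField.adjoin L {v} = ⊤) : Algebra.FormallyEtale F[X] K := by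
  have := isSeparable_of_sq_eq h2 h0 hv hnot htop
  have : Algebra.FormallyEtale L K := Algebra.FormallyEtale.of_isSeparable L K
  have : Algebra.FormallyEtale F[X] L :=
    Algebra.FormallyEtale.of_isLocalization (nonZeroDivisors F[X])
  exact Algebra.FormallyEtale.comp F[X] L K

end DoubleCover

/-! ### Differentials of K, and valuation rings as points. -/

section

variable {F K : Type*} [Field F] [Field K]
  [Algebra F K] [Algebra F[X] K] [IsScalarTower F F[X] K]

theorem exists_kaehlerDifferential_equiv [Algebra.FormallyEtale F[X] K] :
    ∃ e : Ω[K⁄F] ≃ₗ[K] K, e (KaehlerDifferential.D F K (algebraMap F[X] K X)) = 1 := by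
  let e₁ := (KaehlerDifferential.tensorKaehlerEquivOfFormallyEtale F F[X] K).symm
  let e₂ := (KaehlerDifferential.polynomialEquiv F).baseChange F[X] K _ _
  let e₃ := TensorProduct.AlgebraTensorModule.rid F[X] K K
  refine ⟨e₁ ≪≫ₗ e₂ ≪≫ₗ e₃, ?_⟩
  simp [e₁, e₂, e₃, KaehlerDifferential.tensorKaehlerEquivOfFormallyEtale_symm_D_algebraMap]

end

/-- A valuation ring of the fraction field of a Dedekind domain `A` that contains `A` is the
localization of `A` at a prime ideal. -/
theorem ValuationSubring.exists_eq_div_of_isDedekindDomain {A K : Type*} [CommRing A]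
    [IsDedekindDomain A] [Field K] [Algebra A K] [IsFractionRing A K] (O : ValuationSubring K)
    (hA : ∀ a : A, algebraMap A K a ∈ O) {b : K} (hb : b ∈ O) :
    ∃ r t : A, t ≠ 0 ∧ (algebraMap A K t)⁻¹ ∈ O ∧ b = algebraMap A K r / algebraMap A K t := by
  let φ : A →+* O := (algebraMap A K).codRestrict O.toSubring hA
  -- P is the center of O on A. Elements outside P are units of O, so denominators prime to P are
  -- allowed.
  let P : Ideal A := (IsLocalRing.maximalIdeal O).comap φ
  have hP : P.IsPrime := Ideal.comap_isPrime φ _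
  have hinj := IsFractionRing.injective A K
  have hunit : ∀ t : A, t ∉ P → (algebraMap A K t)⁻¹ ∈ O := by
    intro t ht
    have h1 : IsUnit (φ t) := by
      by_contra h
      exact ht ((IsLocalRing.mem_maximalIdeal _).2 h)
    obtain ⟨c, hc⟩ := h1.exists_right_inv
    have h2 : algebraMap A K t * (c : K) = 1 := congrArg Subtype.val hc
    rw [inv_eq_of_mul_eq_one_right h2]
    exact c.2
  have hne : ∀ t : A, t ∉ P → t ≠ 0 := fun t ht h => ht (h ▸ P.zero_mem)
  obtain ⟨r, t, ht, rfl⟩ := IsFractionRing.div_surjective (A := A) b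
  have ht0 := nonZeroDivisors.ne_zero ht
  have ht0' : algebraMap A K t ≠ 0 := (map_ne_zero_iff _ hinj).2 ht0
  by_cases hbot : P = ⊥
  · exact ⟨r, t, ht0, hunit t (by simpa [hbot] using ht0), rfl⟩
  have : IsDiscreteValuationRing (Localization.AtPrime P) :=
    IsLocalization.AtPrime.isDiscreteValuationRing_of_dedekind_domain A hbot _
  have hle : P.primeCompl ≤ nonZeroDivisors A := P.primeCompl_le_nonZeroDivisors
  have hloc : Function.Injective (algebraMap A (Localization.AtPrime P)) :=
    IsLocalization.injective _ hle
  have hdvd : ∀ x y : A, algebraMap A (Localization.AtPrime P) x ∣ algebraMap A _ y →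
      ∃ c s : A, s ∉ P ∧ y * s = x * c := by
    rintro x y ⟨z, hz⟩
    obtain ⟨⟨c, s⟩, hs⟩ := IsLocalization.surj P.primeCompl z
    refine ⟨c, s, s.2, hloc ?_⟩
    rw [map_mul, map_mul, hz, ← hs, mul_assoc]
  -- If t divides r locally, then b = c/s with s outside P. Otherwise ts = rc, so b = s/c, and 1/c =
  -- b · (1/s) still lies in O.
  rcases ValuationRing.dvd_total (algebraMap A (Localization.AtPrime P) t) (algebraMap A _ r)
    with h | h
  · obtain ⟨c, s, hs, hcs⟩ := hdvd _ _ h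
    refine ⟨c, s, hne s hs, hunit s hs, ?_⟩
    rw [div_eq_div_iff ht0' ((map_ne_zero_iff _ hinj).2 (hne s hs)), ← map_mul, ← map_mul, hcs,
      mul_comm]
  · obtain ⟨c, s, hs, hcs⟩ := hdvd _ _ h
    have hs0 := (map_ne_zero_iff _ hinj).2 (hne s hs)
    have hcs' := congrArg (algebraMap A K) hcs
    rw [map_mul, map_mul] at hcs'
    have hc0 : algebraMap A K c ≠ 0 := by
      rintro h0
      rw [h0, mul_zero] at hcs'
      exact mul_ne_zero ht0' hs0 hcs'
    refine ⟨s, c, (map_ne_zero_iff _ hinj).1 hc0, ?_, ?_⟩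
    · have : (algebraMap A K c)⁻¹ = algebraMap A K r / algebraMap A K t * (algebraMap A K s)⁻¹ := by
        field_simp
        linear_combination hcs'
      rw [this]
      exact O.mul_mem _ _ hb (hunit s hs)
    · rw [div_eq_div_iff ht0' hc0, ← hcs', mul_comm]

/-- The integral closure of a subring of a field is the intersection of the valuation rings above
it. The rest of the proof moves from the image of F[X] to F[X] itself. -/
theorem isIntegral_of_forall_mem_valuationSubring {F K : Type*} [Field F] [Field K] [Algebra F K]
    [Algebra F[X] K] [IsScalarTower F F[X] K] {w : K}
    (hw : ∀ O : ValuationSubring K, (∀ c : F, algebraMap F K c ∈ O) → algebraMap F[X] K X ∈ O →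
      w ∈ O) : IsIntegral F[X] w := by
  have h1 : w ∈ (⨅ V : {V : ValuationSubring K //
      (Set.range (algebraMap F[X] K)) ⊆ V.toSubring}, V.1.toSubring) := by
    rw [Subring.mem_iInf]
    rintro ⟨V, hV⟩
    refine hw V (fun c => hV ⟨C c, ?_⟩) (hV ⟨X, rfl⟩)
    exact (IsScalarTower.algebraMap_apply F F[X] K c).symm
  rw [iInf_valuationSubring_superset] at h1
  have h2 : IsIntegral (Subring.closure (Set.range (algebraMap F[X] K))) w := h1
  have h3 : Subring.closure (Set.range (algebraMap F[X] K)) = (algebraMap F[X] K).range := by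
    rw [← RingHom.coe_range, Subring.closure_eq]
  rw [h3] at h2
  obtain ⟨q, hq, hq0⟩ := h2
  have hl : q ∈ lifts (algebraMap F[X] K).rangeRestrict := by
    rw [lifts_iff_coeff_lifts]
    exact fun n => (algebraMap F[X] K).rangeRestrict_surjective _
  obtain ⟨q', hq', -, hmon⟩ := lifts_and_natDegree_eq_and_monic hl hq
  refine ⟨q', hmon, ?_⟩
  rw [← hq', eval₂_map] at hq0
  exact hq0

theorem IntermediateField.adjoin_singleton_eq_top_of_adjoin_pair {F L K : Type*} [Field F]
    [Field L] [Field K] [Algebra F L] [Algebra L K] [Algebra F K] [IsScalarTower F L K] {u v : K}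
    (hu : u ∈ (algebraMap L K).range) (h : IntermediateField.adjoin F {u, v} = ⊤) :
    IntermediateField.adjoin L {v} = ⊤ := by
  apply IntermediateField.restrictScalars_injective F
  rw [IntermediateField.restrictScalars_top, eq_top_iff, ← h, IntermediateField.adjoin_le_iff]
  rintro w (rfl | rfl)
  · obtain ⟨c, rfl⟩ := hu
    exact (IntermediateField.adjoin L {v}).algebraMap_mem c
  · exact IntermediateField.mem_adjoin_simple_self L w

/-! ### The coordinate ring of an affine chart and its local rings. -/

namespace IsFunctionFieldOfSqEq

variable {F K : Type*} [Field F] [Field K] [Algebra F K] {h : F[X]} {u v : K}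

/-- The structures depend on u, which differs between the two charts, so they are supplied
existentially. -/
theorem exists_algebra (H : IsFunctionFieldOfSqEq F K h u v) (hsq : Squarefree h)
    (hdeg : 0 < h.natDegree) :
    ∃ (_ : Algebra F[X] K) (_ : Algebra (FractionRing F[X]) K),
      IsScalarTower F F[X] K ∧ IsScalarTower F[X] (FractionRing F[X]) K ∧
      (∀ q : F[X], algebraMap F[X] K q = aeval u q) ∧
      v ∉ (algebraMap (FractionRing F[X]) K).range ∧
      IntermediateField.adjoin (FractionRing F[X]) {v} = ⊤ := by
  let i₁ : Algebra F[X] K := (aeval u).toRingHom.toAlgebra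
  have hinj : Function.Injective (algebraMap F[X] K) :=
    transcendental_iff_injective.1 H.transcendental
  have : FaithfulSMul F[X] K := (faithfulSMul_iff_algebraMap_injective _ _).2 hinj
  let i₂ : Algebra (FractionRing F[X]) K := FractionRing.liftAlgebra F[X] K
  have t₁ : IsScalarTower F F[X] K := .of_algebraMap_eq fun c => ((aeval_C u c).symm : _)
  have t₂ : IsScalarTower F[X] (FractionRing F[X]) K := FractionRing.isScalarTower_liftAlgebra _ _
  have hmap : ∀ q : F[X], algebraMap F[X] K q = aeval u q := fun _ => rfl
  refine ⟨i₁, i₂, t₁, t₂, hmap, ?_, ?_⟩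
  · exact notMem_range_of_sq_eq_squarefree hsq hdeg (by rw [H.equation, hmap])
  · have t₃ : IsScalarTower F (FractionRing F[X]) K := .of_algebraMap_eq fun c => by
      rw [IsScalarTower.algebraMap_apply F F[X] (FractionRing F[X]),
        ← IsScalarTower.algebraMap_apply F[X], ← IsScalarTower.algebraMap_apply F F[X] K]
    refine IntermediateField.adjoin_singleton_eq_top_of_adjoin_pair ⟨algebraMap F[X] _ X, ?_⟩
      H.adjoin_eq_top
    rw [← IsScalarTower.algebraMap_apply, hmap, aeval_X]

theorem exists_eq_of_forall_valuationSubring (H : IsFunctionFieldOfSqEq F K h u v)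
    (h2 : (2 : F) ≠ 0) (hsq : Squarefree h) (hdeg : 0 < h.natDegree) {w : K}
    (hw : ∀ O : ValuationSubring K, (∀ c : F, algebraMap F K c ∈ O) → u ∈ O → w ∈ O) :
    ∃ a b : F[X], w = aeval u a + aeval u b * v := by
  obtain ⟨_, _, _, _, hmap, hnot, htop⟩ := H.exists_algebra hsq hdeg
  simp only [← hmap]
  refine exists_eq_add_mul_of_isIntegral h2 hsq (by rw [H.equation, hmap]) hnot htop
    (isIntegral_of_forall_mem_valuationSubring fun O hF hX => hw O hF ?_)
  rwa [hmap, aeval_X] at hX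

theorem exists_kaehlerDifferential_equiv (H : IsFunctionFieldOfSqEq F K h u v)
    (h2 : (2 : F) ≠ 0) (hsq : Squarefree h) (hdeg : 0 < h.natDegree) :
    ∃ e : KaehlerDifferential F K ≃ₗ[K] K, e (KaehlerDifferential.D F K u) = 1 := by
  obtain ⟨_, _, _, _, hmap, hnot, htop⟩ := H.exists_algebra hsq hdeg
  have := formallyEtale_of_sq_eq h2 hsq.ne_zero (by rw [H.equation, hmap]) hnot htop
  simpa [hmap] using _root_.exists_kaehlerDifferential_equiv (F := F) (K := K)

theorem aeval_add_mul_mem (H : IsFunctionFieldOfSqEq F K h u v) {O : ValuationSubring K}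
    (hF : ∀ c : F, algebraMap F K c ∈ O) (hu : u ∈ O) (a b : F[X]) :
    aeval u a + aeval u b * v ∈ O := by
  have hX : ∀ q : F[X], aeval u q ∈ O := fun q => by
    rw [aeval_eq_sum_range]
    refine sum_mem fun i _ => ?_
    rw [Algebra.smul_def]
    exact O.mul_mem _ _ (hF _) (pow_mem hu _)
  have hv : v ∈ O := by
    rcases O.mem_or_inv_mem v with hv | hv
    · exact hv
    · have := O.mul_mem _ _ (hX h) hv
      rw [← H.equation] at this
      by_cases h0 : v = 0
      · exact h0 ▸ O.zero_mem
      · rwa [pow_two, mul_assoc, mul_inv_cancel₀ h0, mul_one] at this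
  exact O.add_mem _ _ (hX a) (O.mul_mem _ _ (hX b) hv)

theorem exists_eq_div_of_mem_valuationSubring (H : IsFunctionFieldOfSqEq F K h u v)
    (h2 : (2 : F) ≠ 0) (hsq : Squarefree h) (hdeg : 0 < h.natDegree) {O : ValuationSubring K}
    (hF : ∀ c : F, algebraMap F K c ∈ O) (hu : u ∈ O) {w : K} (hw : w ∈ O) :
    ∃ a b c d : F[X], aeval u c + aeval u d * v ≠ 0 ∧ (aeval u c + aeval u d * v)⁻¹ ∈ O ∧
      w = (aeval u a + aeval u b * v) / (aeval u c + aeval u d * v) := by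
  obtain ⟨_, _, _, _, hmap, hnot, htop⟩ := H.exists_algebra hsq hdeg
  have hv : v ^ 2 = algebraMap F[X] K h := by rw [H.equation, hmap]
  have := finiteDimensional_of_sq_eq hv htop
  have := isSeparable_of_sq_eq h2 hsq.ne_zero hv hnot htop
  have := integralClosure.isFractionRing_of_finite_extension (A := F[X]) (FractionRing F[X]) K
  obtain ⟨r, t, ht0, ht, rfl⟩ := O.exists_eq_div_of_isDedekindDomain
    (A := integralClosure F[X] K) (fun z => by
      obtain ⟨a, b, hab⟩ := exists_eq_add_mul_of_isIntegral h2 hsq hv hnot htop z.2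
      change (z : K) ∈ O
      rw [hab, hmap, hmap]
      exact H.aeval_add_mul_mem hF hu a b) hw
  obtain ⟨a, b, hab⟩ := exists_eq_add_mul_of_isIntegral h2 hsq hv hnot htop r.2
  obtain ⟨c, d, hcd⟩ := exists_eq_add_mul_of_isIntegral h2 hsq hv hnot htop t.2
  simp only [← hmap]
  refine ⟨a, b, c, d, ?_, ?_, ?_⟩
  · rw [← hcd]; simpa using ht0
  · rw [← hcd]; exact ht
  · rw [← hcd, ← hab]; rfl

end IsFunctionFieldOfSqEq

/-! ### Regular differentials on an affine chart. -/

namespace IsFunctionFieldOfSqEq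

variable {F K : Type*} [Field F] [Field K] [Algebra F K] {h : F[X]} {u v : K}

local notation "d" => KaehlerDifferential.D F K

theorem aeval_ne_zero (H : IsFunctionFieldOfSqEq F K h u v) {q : F[X]} (hq : q ≠ 0) :
    aeval u q ≠ 0 := fun h0 => hq (transcendental_iff.1 H.transcendental q h0)

theorem ne_zero (H : IsFunctionFieldOfSqEq F K h u v) (h0 : h ≠ 0) : v ≠ 0 := by
  rintro rfl
  apply H.aeval_ne_zero h0
  rw [← H.equation]; simp

theorem D_snd_eq_smul (H : IsFunctionFieldOfSqEq F K h u v) (h2 : (2 : F) ≠ 0) (h0 : h ≠ 0) :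
    d v = aeval u (C 2⁻¹ * derivative h) • (v⁻¹ • d u) := by
  have hv := H.ne_zero h0
  have h2K : (2 : K) ≠ 0 := by
    rw [← map_ofNat (algebraMap F K) 2]
    exact (_root_.map_ne_zero _).2 h2
  have hc : algebraMap F K 2⁻¹ * 2 = 1 := by
    rw [← map_ofNat (algebraMap F K) 2, ← map_mul, inv_mul_cancel₀ h2, map_one]
  have h1 : d (v ^ 2) = aeval u (derivative h) • d u := by
    rw [H.equation, Derivation.map_aeval]
  have h3 : (2 * v) • d v = aeval u (derivative h) • d u := by
    rw [← h1, Derivation.leibniz_pow, mul_smul, ofNat_smul_eq_nsmul]; simp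
  rw [← inv_smul_smul₀ (mul_ne_zero h2K hv) (d v), h3, smul_smul, smul_smul]
  congr 1
  rw [map_mul, aeval_C, eq_inv_of_mul_eq_one_left hc]
  field_simp

theorem D_aeval_add_mul (H : IsFunctionFieldOfSqEq F K h u v) (h2 : (2 : F) ≠ 0) (h0 : h ≠ 0)
    (a b : F[X]) : d (aeval u a + aeval u b * v) =
      (aeval u (derivative b * h + b * (C 2⁻¹ * derivative h)) + aeval u (derivative a) * v) •
        (v⁻¹ • d u) := by
  have hu : d u = v • (v⁻¹ • d u) := (smul_inv_smul₀ (H.ne_zero h0) _).symm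
  rw [map_add, Derivation.leibniz, Derivation.map_aeval, Derivation.map_aeval,
    H.D_snd_eq_smul h2 h0]
  nth_rw 1 [hu]
  nth_rw 3 [hu]
  simp only [smul_smul, ← add_smul]
  congr 1
  simp only [map_add, map_mul, ← H.equation]
  ring

/-- Elements of O are quotients of chart functions with denominator invertible in O, so the quotient
rule puts their differentials in O · du/v. Conversely, Ah + Bh' = 1 gives du/v = Av du + 2B dv. -/
theorem isRegularDifferentialAt_iff (H : IsFunctionFieldOfSqEq F K h u v)
    (h2 : (2 : F) ≠ 0) (hsep : h.Separable) (hdeg : 0 < h.natDegree) {O : ValuationSubring K}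
    (hF : ∀ c : F, algebraMap F K c ∈ O) (hu : u ∈ O) (w : K) :
    IsRegularDifferentialAt F O (w • (v⁻¹ • d u)) ↔ w ∈ O := by
  have h0 : h ≠ 0 := hsep.ne_zero
  have hv := H.ne_zero h0
  have hmem := fun a b => H.aeval_add_mul_mem (O := O) hF hu a b
  have hX : ∀ a : F[X], aeval u a ∈ O := fun a => by simpa using hmem a 0
  have hvO : v ∈ O := by simpa using hmem 0 1
  obtain ⟨e, he⟩ := H.exists_kaehlerDifferential_equiv h2 hsep.squarefree hdeg
  constructor
  · intro hreg
    suffices ∃ c ∈ O, w • (v⁻¹ • d u) = c • (v⁻¹ • d u) by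
      obtain ⟨c, hc, hwc⟩ := this
      have := congrArg e hwc
      simp only [map_smul, he, smul_eq_mul, mul_one] at this
      rwa [mul_right_cancel₀ (inv_ne_zero hv) this]
    refine Submodule.span_induction (p := fun ω _ => ∃ c ∈ O, ω = c • (v⁻¹ • d u))
      ?_ ⟨0, O.zero_mem, by simp⟩ ?_ ?_ hreg
    · rintro _ ⟨b, hb, rfl⟩
      obtain ⟨p, q, r, s, ht0, ht, rfl⟩ :=
        H.exists_eq_div_of_mem_valuationSubring h2 hsep.squarefree hdeg hF hu hb
      rw [Derivation.leibniz_div, H.D_aeval_add_mul h2 h0, H.D_aeval_add_mul h2 h0]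
      generalize v⁻¹ • d u = η
      rw [smul_smul, smul_smul, ← sub_smul, smul_smul]
      refine ⟨_, ?_, rfl⟩
      exact O.mul_mem _ _ (by simpa using pow_mem ht 2)
        (O.sub_mem (O.mul_mem _ _ (hmem _ _) (hmem _ _)) (O.mul_mem _ _ (hmem _ _) (hmem _ _)))
    · rintro _ _ _ _ ⟨c, hc, rfl⟩ ⟨c', hc', rfl⟩
      exact ⟨c + c', O.add_mem _ _ hc hc', (add_smul _ _ _).symm⟩
    · rintro ⟨a, ha⟩ _ _ ⟨c, hc, rfl⟩
      exact ⟨a * c, O.mul_mem _ _ ha hc, by rw [mul_smul]; rfl⟩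
  · intro hw
    obtain ⟨A, B, hAB⟩ := hsep
    have h1 : w • (v⁻¹ • d u) = (w * (aeval u A * v)) • d u + (w * aeval u (C 2 * B)) • d v := by
      rw [H.D_snd_eq_smul h2 h0]
      have hu : d u = v • (v⁻¹ • d u) := (smul_inv_smul₀ hv _).symm
      nth_rw 2 [hu]
      simp only [smul_smul, ← add_smul]
      congr 1
      have hc : algebraMap F K 2 * algebraMap F K 2⁻¹ = 1 := by
        rw [← map_mul, mul_inv_cancel₀ h2, map_one]
      have hAB' := congrArg (aeval u) hAB
      simp only [map_add, map_mul, map_one, ← H.equation] at hAB'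
      simp only [map_mul, aeval_C]
      linear_combination
        (-w * v⁻¹) * hAB' - w * v⁻¹ * aeval u B * aeval u (derivative h) * hc
    rw [h1]
    have key : ∀ a ∈ O, ∀ b ∈ O, a • d b ∈ Submodule.span O.toSubring (d '' (O : Set K)) :=
      fun a ha b hb => Submodule.smul_mem _ (⟨a, ha⟩ : O.toSubring)
        (Submodule.subset_span ⟨b, hb, rfl⟩)
    exact Submodule.add_mem _
      (key _ (O.mul_mem _ _ hw (O.mul_mem _ _ (hX _) hvO)) _ hu)
      (key _ (O.mul_mem _ _ hw (hX _)) _ hvO)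

end IsFunctionFieldOfSqEq

/-! ### The chart at infinity and the holomorphic differentials. -/

namespace IsFunctionFieldOfSqEq

variable {F K : Type*} [Field F] [Field K] [Algebra F K] {h : F[X]} {x y : K}

local notation "d" => KaehlerDifferential.D F K

theorem eq_zero_of_aeval_add_mul_eq_zero (H : IsFunctionFieldOfSqEq F K h x y)
    (hsq : Squarefree h) (hdeg : 0 < h.natDegree) {a b : F[X]}
    (hab : aeval x a + aeval x b * y = 0) : a = 0 ∧ b = 0 := by
  have hb : b = 0 := by
    by_contra hb
    obtain ⟨_, _, _, _, hmap, hnot, -⟩ := H.exists_algebra hsq hdeg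
    have hb' := H.aeval_ne_zero hb
    refine hnot ⟨-(algebraMap F[X] _ a / algebraMap F[X] _ b), ?_⟩
    rw [map_neg, map_div₀, ← IsScalarTower.algebraMap_apply, ← IsScalarTower.algebraMap_apply,
      hmap, hmap, ← neg_div, div_eq_iff hb']
    linear_combination -hab
  refine ⟨?_, hb⟩
  by_contra ha
  apply H.aeval_ne_zero ha
  simpa [hb] using hab

theorem separable_X_pow_add_one {m : ℕ} (hm : (m : F) ≠ 0) : (X ^ m + 1 : F[X]).Separable := by
  have := separable_X_pow_sub_C (-1 : F) hm (by simp)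
  simpa using this

theorem separable_X_pow_mul_X_pow_add_one {m ε : ℕ} (hm : (m : F) ≠ 0) (hε : ε ≤ 1) :
    (X ^ ε * (X ^ m + 1) : F[X]).Separable := by
  interval_cases ε
  · simpa using separable_X_pow_add_one hm
  · rw [pow_one]
    refine separable_X.mul (separable_X_pow_add_one hm) ?_
    obtain ⟨n, rfl⟩ : ∃ n, m = n + 1 := Nat.exists_eq_succ_of_ne_zero (by rintro rfl; simp at hm)
    exact ⟨-X ^ n, 1, by ring⟩

theorem natDegree_X_pow_add_one {m : ℕ} : (X ^ m + 1 : F[X]).natDegree = m := by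
  simpa using natDegree_X_pow_add_C (n := m) (r := (1 : F))

theorem natDegree_X_pow_mul_X_pow_add_one {m ε : ℕ} (hm : 0 < m) :
    (X ^ ε * (X ^ m + 1) : F[X]).natDegree = ε + m := by
  have h0 : (X ^ m + 1 : F[X]) ≠ 0 := by
    simpa using X_pow_add_C_ne_zero hm (1 : F)
  rw [natDegree_mul (pow_ne_zero _ X_ne_zero) h0, natDegree_X_pow, natDegree_X_pow_add_one]

variable {m ε g : ℕ}

/-- With u = 1/x, v^2 = u^(m+ε) (x^m + 1) = u^ε (1 + u^m). The correction ε makes the exponent even.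
-/
theorem inv_chart (H : IsFunctionFieldOfSqEq F K (X ^ m + 1) x y) (hg : m + ε = 2 * g + 2) :
    IsFunctionFieldOfSqEq F K (X ^ ε * (X ^ m + 1)) x⁻¹ (y * x⁻¹ ^ (g + 1)) where
  transcendental := fun h => H.transcendental (by simpa using h.inv)
  equation := by
    have hx : x ≠ 0 := by simpa using H.aeval_ne_zero (X_ne_zero)
    have hy := H.equation
    simp only [map_add, map_pow, aeval_X, map_one, map_mul] at hy ⊢
    rw [mul_pow, hy, ← pow_mul, show (g + 1) * 2 = ε + m by omega, pow_add]
    have : x ^ m * x⁻¹ ^ m = 1 := by rw [← mul_pow, mul_inv_cancel₀ hx, one_pow]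
    linear_combination x⁻¹ ^ ε * this
  adjoin_eq_top := by
    have hx : x ≠ 0 := by simpa using H.aeval_ne_zero (X_ne_zero)
    rw [eq_top_iff, ← H.adjoin_eq_top, IntermediateField.adjoin_le_iff]
    set E := IntermediateField.adjoin F {x⁻¹, y * x⁻¹ ^ (g + 1)}
    have h1 : x⁻¹ ∈ E := IntermediateField.subset_adjoin _ _ (by simp)
    have h2 : y * x⁻¹ ^ (g + 1) ∈ E := IntermediateField.subset_adjoin _ _ (by simp)
    have h3 : x ∈ E := by simpa using E.inv_mem h1
    have h4 : y ∈ E := by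
      have := E.mul_mem h2 (pow_mem h3 (g + 1))
      rwa [mul_assoc, ← mul_pow, inv_mul_cancel₀ hx, one_pow, mul_one] at this
    rintro z (rfl | rfl) <;> assumption

theorem smul_eq_smul_inv_chart (hx : x ≠ 0) (w : K) :
    w • (y⁻¹ • d x) =
      (-(w * x⁻¹ ^ (g + 1) * x ^ 2)) • ((y * x⁻¹ ^ (g + 1))⁻¹ • d x⁻¹) := by
  rw [Derivation.leibniz_inv, smul_smul, smul_smul, smul_smul]
  congr 1
  by_cases hy : y = 0
  · simp [hy]
  · field_simp

theorem aeval_reflect (hx : x ≠ 0) {N : ℕ} {c : F[X]} (hN : c.natDegree ≤ N) :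
    aeval x (reflect N c) = x ^ N * aeval x⁻¹ c := by
  let := invertibleOfNonzero (inv_ne_zero hx)
  have := eval₂_reflect_mul_pow (algebraMap F K) x⁻¹ N c hN
  rw [invOf_eq_inv, inv_inv] at this
  rw [aeval_def, aeval_def, ← this, mul_comm, mul_assoc, ← mul_pow, inv_mul_cancel₀ hx, one_pow,
    mul_one]

theorem smul_mem_holomorphicDifferentials_iff (H : IsFunctionFieldOfSqEq F K (X ^ m + 1) x y)
    (h2 : (2 : F) ≠ 0) (hm : (m : F) ≠ 0) (hε : ε ≤ 1) (hg : m + ε = 2 * g + 2) (w : K) :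
    w • (y⁻¹ • d x) ∈ holomorphicDifferentials F K ↔
      ∃ a : F[X], (∀ i, g ≤ i → a.coeff i = 0) ∧ w = aeval x a := by
  have hx : x ≠ 0 := by simpa using H.aeval_ne_zero (X_ne_zero)
  have hm0 : 0 < m := Nat.pos_of_ne_zero (by rintro rfl; simp at hm)
  have hsep := separable_X_pow_add_one hm
  have hdeg : 0 < (X ^ m + 1 : F[X]).natDegree := by rwa [natDegree_X_pow_add_one]
  have hsep' := separable_X_pow_mul_X_pow_add_one hm hε
  have hdeg' : 0 < (X ^ ε * (X ^ m + 1) : F[X]).natDegree := by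
    rw [natDegree_X_pow_mul_X_pow_add_one hm0]; omega
  have H' := H.inv_chart hg
  have hreg := fun O hF hu => H.isRegularDifferentialAt_iff h2 hsep hdeg (O := O) hF hu w
  have hreg' := fun O hF hu => H'.isRegularDifferentialAt_iff h2 hsep' hdeg' (O := O) hF hu
    (-(w * x⁻¹ ^ (g + 1) * x ^ 2))
  rw [← smul_eq_smul_inv_chart hx] at hreg'
  constructor
  · intro hw
    obtain ⟨a, b, hab⟩ := H.exists_eq_of_forall_valuationSubring h2 hsep.squarefree hdeg
      fun O hF hu => (hreg O hF hu).1 (hw O hF)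
    obtain ⟨c, e, hce⟩ := H'.exists_eq_of_forall_valuationSubring h2 hsep'.squarefree hdeg'
      fun O hF hu => (hreg' O hF hu).1 (hw O hF)
    obtain ⟨N, hcN, heN⟩ : ∃ N, c.natDegree ≤ N ∧ e.natDegree ≤ N :=
      ⟨_, le_max_left _ _, le_max_right _ _⟩
    have hc := aeval_reflect hx hcN
    have he := aeval_reflect hx heN
    -- Equate the two chart expansions of w and multiply by x^(N+g+1). The reflected polynomials
    -- have degree at most N, so the y-part forces b = 0 and the other part forces deg a < g.
    obtain ⟨h3, h4⟩ := H.eq_zero_of_aeval_add_mul_eq_zero hsep.squarefree hdeg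
      (a := a * X ^ (N + 2) + X ^ (g + 1) * reflect N c) (b := b * X ^ (N + 2) + reflect N e) (by
        simp only [map_add, map_mul, map_pow, aeval_X, hc, he]
        have h5 : x ^ (g + 1) * x⁻¹ ^ (g + 1) = 1 := by
          rw [← mul_pow, mul_inv_cancel₀ hx, one_pow]
        rw [hab] at hce
        linear_combination (-(x ^ N * x ^ (g + 1))) * hce +
          (-(x ^ N * x ^ 2 * (aeval x a + aeval x b * y)) - x ^ N * aeval x⁻¹ e * y) * h5)
    have hdr : ∀ q : F[X], q.natDegree ≤ N → (reflect N q).natDegree ≤ N := fun q hq =>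
      (natDegree_reflect_le).trans (max_le le_rfl hq)
    have hb : b = 0 := by
      by_contra hb
      have h5 := congrArg natDegree (eq_neg_of_add_eq_zero_left h4)
      rw [natDegree_neg, natDegree_mul hb (pow_ne_zero _ X_ne_zero), natDegree_X_pow] at h5
      have := hdr e heN
      omega
    refine ⟨a, fun i hi => ?_, by simpa [hb] using hab⟩
    have h5 := congrArg (coeff · (i + (N + 2))) (eq_neg_of_add_eq_zero_left h3)
    simp only [coeff_mul_X_pow, coeff_neg] at h5
    rw [h5, neg_eq_zero]
    apply coeff_eq_zero_of_natDegree_lt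
    have h6 := natDegree_mul_le (p := (X ^ (g + 1) : F[X])) (q := reflect N c)
    rw [natDegree_X_pow] at h6
    have := hdr c hcN
    omega
  · rintro ⟨a, ha, rfl⟩ O hF
    rcases O.mem_or_inv_mem x with hxO | hxO
    · rw [hreg O hF hxO]
      simpa using H.aeval_add_mul_mem hF hxO a 0
    · rw [hreg' O hF hxO, neg_mem_iff, aeval_eq_sum_range, Finset.sum_mul, Finset.sum_mul]
      refine sum_mem fun i _ => ?_
      by_cases hi : g ≤ i
      · simp [ha i hi, O.zero_mem]
      · push Not at hi
        rw [Algebra.smul_def]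
        -- The bound i < g is exactly what leaves a nonnegative power of 1/x.
        have : algebraMap F K (a.coeff i) * x ^ i * x⁻¹ ^ (g + 1) * x ^ 2 =
            algebraMap F K (a.coeff i) * x⁻¹ ^ (g - 1 - i) := by
          obtain ⟨n, rfl⟩ : ∃ n, g = i + 1 + n := ⟨g - 1 - i, by omega⟩
          rw [show i + 1 + n - 1 - i = n by omega]
          have hpow : x ^ (i + 2) * x⁻¹ ^ (i + 2) = 1 := by
            rw [← mul_pow, mul_inv_cancel₀ hx, one_pow]
          linear_combination algebraMap F K (a.coeff i) * x⁻¹ ^ n * hpow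
        rw [this]
        exact O.mul_mem _ _ (hF _) (pow_mem hxO _)

end IsFunctionFieldOfSqEq

/-! ### Exactness in characteristic p. -/

/-- In characteristic `p`, the `p`-th iterate of the commutator with `T` is the commutator
with `T ^ p`. -/
theorem iterate_char_commutator (F : Type*) {A : Type*} [Field F] [Ring A] [Algebra F A]
    [Nontrivial A] {p : ℕ} [Fact p.Prime] [CharP F p] (T S : A) :
    (fun S => T * S - S * T)^[p] S = T ^ p * S - S * T ^ p := by
  have : CharP (Module.End F A) p :=
    charP_of_injective_algebraMap (algebraMap F (Module.End F A)).injective p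
  -- Left and right multiplication by T commute, so the Frobenius identity applies to their
  -- difference.
  have h := LinearMap.congr_fun
    (sub_pow_char_of_commute p (LinearMap.commute_mulLeft_right (R := F) T T)) S
  rwa [LinearMap.pow_mulLeft, LinearMap.pow_mulRight, Module.End.pow_apply] at h

/-- In characteristic `p`, the `p`-th iterate of a derivation satisfies the Leibniz rule. -/
theorem Derivation.iterate_char_mul {F K : Type*} [Field F] [Field K] [Algebra F K] {p : ℕ}
    [Fact p.Prime] [CharP F p] (δ : Derivation F K K) (a b : K) :
    δ^[p] (a * b) = a * δ^[p] b + b * δ^[p] a := by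
  let T : Module.End F K := δ.toLinearMap
  have hT : ∀ (n : ℕ) (z : K), (T ^ n) z = δ^[n] z := fun n z => Module.End.pow_apply _ _ _
  -- The Leibniz rule says that the commutator of δ with multiplication by z is multiplication by δ
  -- z.
  have hstep : ∀ z, T * LinearMap.mulLeft F z - LinearMap.mulLeft F z * T =
      LinearMap.mulLeft F (δ z) := by
    intro z
    ext w
    change δ (z * w) - z * δ w = δ z * w
    rw [Derivation.leibniz, smul_eq_mul, smul_eq_mul]
    ring
  have hiter : ∀ n : ℕ, (fun S => T * S - S * T)^[n] (LinearMap.mulLeft F a) =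
      LinearMap.mulLeft F (δ^[n] a) := by
    intro n
    induction n with
    | zero => rfl
    | succ n ih => rw [Function.iterate_succ_apply', ih, hstep, Function.iterate_succ_apply']
  have h := hiter p
  rw [iterate_char_commutator F] at h
  have h' := LinearMap.congr_fun h b
  simp only [LinearMap.sub_apply, LinearMap.mulLeft_apply, Module.End.mul_apply, hT] at h'
  rw [mul_comm b, ← h']
  ring

/-- The coefficient of X^(np) in the derivative is this one times (np + p - 1) ⋯ (np + 1), which is
prime to p. -/
theorem Polynomial.coeff_eq_zero_of_iterate_derivative_eq_zero {F : Type*} [Field F] {p : ℕ}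
    [Fact p.Prime] [CharP F p] {q : F[X]} (hq : derivative^[p - 1] q = 0) (n : ℕ) :
    q.coeff (n * p + (p - 1)) = 0 := by
  have hp : p.Prime := Fact.out
  have h1 := congrArg (coeff · (n * p)) hq
  simp only [coeff_iterate_derivative, coeff_zero, nsmul_eq_mul] at h1
  refine (mul_eq_zero.1 h1).resolve_left ?_
  rw [CharP.cast_eq_zero_iff F p, Nat.descFactorial_eq_prod_range,
    Prime.dvd_finsetProd_iff hp.prime]
  rintro ⟨i, hi, hd⟩
  rw [Finset.mem_range] at hi
  have h2 : n * p + (p - 1) - i = p * n + (p - 1 - i) := by rw [mul_comm]; omega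
  rw [h2, Nat.dvd_add_right (dvd_mul_right _ _)] at hd
  have := Nat.le_of_dvd (by omega) hd
  omega

theorem Polynomial.exists_derivative_eq {F : Type*} [Field F] {p : ℕ} [Fact p.Prime] [CharP F p]
    {q : F[X]} (hq : ∀ n, q.coeff (n * p + (p - 1)) = 0) : ∃ r : F[X], derivative r = q := by
  have hp : p.Prime := Fact.out
  refine ⟨∑ i ∈ q.support, C (q.coeff i * ((i + 1 : ℕ) : F)⁻¹) * X ^ (i + 1), ?_⟩
  rw [derivative_sum]
  conv_rhs => rw [q.as_sum_support_C_mul_X_pow]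
  refine Finset.sum_congr rfl fun i hi => ?_
  rw [derivative_C_mul_X_pow, Nat.add_sub_cancel, mul_assoc, inv_mul_cancel₀, mul_one]
  rw [Ne, CharP.cast_eq_zero_iff F p]
  rintro ⟨n, hn⟩
  rw [mem_support_iff] at hi
  apply hi
  obtain ⟨k, rfl⟩ : ∃ k, n = k + 1 := Nat.exists_eq_succ_of_ne_zero (by rintro rfl; simp at hn)
  rw [← hq k]
  congr 1
  have := hp.pos
  rw [mul_comm, add_mul] at hn
  omega

namespace IsFunctionFieldOfSqEq

variable {F K : Type*} [Field F] [Field K] [Algebra F K] {h : F[X]} {x y : K}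

local notation "d" => KaehlerDifferential.D F K

theorem exists_derivation (H : IsFunctionFieldOfSqEq F K h x y)
    (h2 : (2 : F) ≠ 0) (hsq : Squarefree h) (hdeg : 0 < h.natDegree) :
    ∃ δ : Derivation F K K, δ x = 1 ∧ (∀ z, d z = δ z • d x) ∧
      ∀ ω : KaehlerDifferential F K, ∃ w : K, ω = w • d x := by
  obtain ⟨e, he⟩ := H.exists_kaehlerDifferential_equiv h2 hsq hdeg
  have key : ∀ ω : KaehlerDifferential F K, ω = e ω • d x := fun ω => e.injective (by rw [map_smul, he]; simp)
  exact ⟨e.toLinearMap.compDer (KaehlerDifferential.D F K), he, fun z => key _, fun ω => ⟨_, key ω⟩⟩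

theorem smul_D_eq_zero_iff (H : IsFunctionFieldOfSqEq F K h x y)
    (h2 : (2 : F) ≠ 0) (hsq : Squarefree h) (hdeg : 0 < h.natDegree) (w : K) :
    w • d x = 0 ↔ w = 0 := by
  obtain ⟨e, he⟩ := H.exists_kaehlerDifferential_equiv h2 hsq hdeg
  rw [← e.map_eq_zero_iff, map_smul, he]
  simp

theorem derivation_eq_zero (H : IsFunctionFieldOfSqEq F K h x y)
    (h2 : (2 : F) ≠ 0) (hsq : Squarefree h) (hdeg : 0 < h.natDegree) {δ : Derivation F K K}
    (hδ : δ x = 0) (z : K) : δ z = 0 := by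
  obtain ⟨_, _, hz, _⟩ := H.exists_derivation h2 hsq hdeg
  rw [← δ.liftKaehlerDifferential_comp_D, hz z, map_smul, δ.liftKaehlerDifferential_comp_D, hδ,
    smul_zero]

/-- δ^p is again a derivation and kills x, hence vanishes on K. So δ z = q(x) forces the (p - 1)-st
derivative of q to be zero. The converse integrates q termwise. -/
theorem exists_derivation_eq_aeval_iff (H : IsFunctionFieldOfSqEq F K h x y)
    (h2 : (2 : F) ≠ 0) (hsq : Squarefree h) (hdeg : 0 < h.natDegree) {p : ℕ} [Fact p.Prime]
    [CharP F p] {δ : Derivation F K K} (hδ : δ x = 1) (q : F[X]) :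
    (∃ z, δ z = aeval x q) ↔ ∀ n, q.coeff (n * p + (p - 1)) = 0 := by
  have hp : p.Prime := Fact.out
  have hiter : ∀ (n : ℕ) (q : F[X]), δ^[n] (aeval x q) = aeval x (derivative^[n] q) := by
    intro n
    induction n with
    | zero => simp
    | succ n ih =>
      intro q
      rw [Function.iterate_succ_apply, Function.iterate_succ_apply, ← ih, Derivation.map_aeval, hδ,
        smul_eq_mul, mul_one]
  constructor
  · rintro ⟨z, hz⟩
    apply Polynomial.coeff_eq_zero_of_iterate_derivative_eq_zero
    have : CharP K p := charP_of_injective_algebraMap (algebraMap F K).injective p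
    have hcoe : ∀ w, (δ.toLinearMap ^ p) w = δ^[p] w := fun w => Module.End.pow_apply _ _ _
    let δp : Derivation F K K := Derivation.mk' (δ.toLinearMap ^ p) fun a b => by
      rw [hcoe, hcoe, hcoe, δ.iterate_char_mul]; rfl
    have hδp : ∀ w, δp w = δ^[p] w := hcoe
    have h0 : δp x = 0 := by
      rw [hδp, show p = p - 2 + 1 + 1 by have := hp.two_le; omega, Function.iterate_succ_apply,
        Function.iterate_succ_apply, hδ, Derivation.map_one_eq_zero]
      exact Function.iterate_fixed (map_zero δ) _
    have h1 := H.derivation_eq_zero h2 hsq hdeg h0 z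
    rw [hδp, show p = p - 1 + 1 by have := hp.pos; omega, Function.iterate_succ_apply, hz,
      hiter] at h1
    by_contra hne
    exact H.aeval_ne_zero hne h1
  · intro hq
    obtain ⟨r, rfl⟩ := Polynomial.exists_derivative_eq hq
    exact ⟨aeval x r, by rw [Derivation.map_aeval, hδ, smul_eq_mul, mul_one]⟩

theorem smul_mem_exactDifferentials_iff (H : IsFunctionFieldOfSqEq F K h x y)
    (h2 : (2 : F) ≠ 0) (hsq : Squarefree h) (hdeg : 0 < h.natDegree) {p r : ℕ} [Fact p.Prime]
    [CharP F p] (hr : p = 2 * r + 1) (a : F[X]) :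
    aeval x a • (y⁻¹ • d x) ∈ exactDifferentials F K ↔
      ∀ n, (a * h ^ r).coeff (n * p + (p - 1)) = 0 := by
  obtain ⟨δ, hδ, hd, -⟩ := H.exists_derivation h2 hsq hdeg
  have hy := H.ne_zero hsq.ne_zero
  have : CharP K p := charP_of_injective_algebraMap (algebraMap F K).injective p
  rw [← H.exists_derivation_eq_aeval_iff h2 hsq hdeg hδ]
  have hpow : ∀ c z, δ (c ^ p * z) = c ^ p * δ z := fun c z => by
    rw [Derivation.leibniz, Derivation.leibniz_pow]
    simp [← Nat.cast_smul_eq_nsmul K]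
  have hah : aeval x (a * h ^ r) = y ^ p * (aeval x a * y⁻¹) := by
    rw [map_mul, map_pow, ← H.equation, ← pow_mul, hr, pow_succ]
    field_simp
  have hex : aeval x a • (y⁻¹ • d x) ∈ exactDifferentials F K ↔
      ∃ z, δ z = aeval x a * y⁻¹ := by
    change (∃ z, d z = _) ↔ _
    refine exists_congr fun z => ?_
    rw [hd z, smul_smul, ← sub_eq_zero, ← sub_smul, H.smul_D_eq_zero_iff h2 hsq hdeg, sub_eq_zero]
  rw [hex, hah]
  constructor
  · rintro ⟨z, hz⟩
    exact ⟨y ^ p * z, by rw [hpow, hz]⟩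
  · rintro ⟨z, hz⟩
    refine ⟨y⁻¹ ^ p * z, ?_⟩
    rw [hpow, hz, ← mul_assoc, ← mul_pow, inv_mul_cancel₀ hy, one_pow, one_mul]

end IsFunctionFieldOfSqEq

/-! ### The coefficient criterion for x^m + 1 and the count of exponents. -/

theorem Polynomial.forall_coeff_mul_X_pow_add_one_pow_eq_zero_iff {F : Type*} [Field F]
    {p r s m : ℕ} [Fact p.Prime] [CharP F p] (hr : p = 2 * r + 1) (hm : m + 1 = s * p) {a : F[X]}
    (ha : ∀ i, m ≤ i → a.coeff i = 0) :
    (∀ n, (a * (X ^ m + 1) ^ r).coeff (n * p + (p - 1)) = 0) ↔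
      ∀ i, a.coeff i ≠ 0 → r < (i + 1) % p := by
  have hp : p.Prime := Fact.out
  have hcoeff : ∀ N, (a * (X ^ m + 1) ^ r).coeff N = ∑ j ∈ Finset.range (r + 1),
      if m * j ≤ N then a.coeff (N - m * j) * (r.choose j : F) else 0 := by
    intro N
    rw [add_pow, Finset.mul_sum, finsetSum_coeff]
    refine Finset.sum_congr rfl fun j _ => ?_
    rw [one_pow, mul_one, ← pow_mul, ← mul_assoc, coeff_mul_natCast, coeff_mul_X_pow', ite_mul,
      zero_mul]
  simp only [hcoeff]
  constructor
  · intro hN i hi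
    by_contra! hj
    -- This is the j for which i + mj is congruent to -1 mod p.
    set j := (i + 1) % p
    have hdm : p * ((i + 1) / p) + j = i + 1 := Nat.div_add_mod _ _
    have hp0 := hp.pos
    obtain ⟨n, hn⟩ : ∃ n, i + m * j = n * p + (p - 1) := by
      have h1 : i + m * j + 1 = p * ((i + 1) / p + s * j) := by
        calc i + m * j + 1 = p * ((i + 1) / p) + (m + 1) * j := by rw [add_mul]; omega
          _ = _ := by rw [hm]; ring
      obtain ⟨n, hn⟩ : ∃ n, (i + 1) / p + s * j = n + 1 :=
        Nat.exists_eq_succ_of_ne_zero fun h0 => by rw [h0] at h1; omega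
      rw [hn] at h1
      refine ⟨n, ?_⟩
      have : p * (n + 1) = n * p + p := by ring
      omega
    have him : i < m := by
      by_contra! h
      exact hi (ha i h)
    have h2 := hN n
    rw [← hn, Finset.sum_eq_single j] at h2
    · rw [if_pos (by omega), Nat.add_sub_cancel] at h2
      have h3 := (mul_eq_zero.1 h2).resolve_left hi
      rw [CharP.cast_eq_zero_iff F p] at h3
      -- The binomial coefficient divides r!, which is prime to p because r < p.
      have h4 : p ∣ r.factorial := by
        rw [← Nat.choose_mul_factorial_mul_factorial hj, mul_assoc]
        exact h3.mul_right _
      have := (hp.dvd_factorial).1 h4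
      omega
    -- A smaller j' would need a coefficient of a at an index at least m; a larger one overshoots,
    -- since i < m.
    · intro j' _ hne
      split_ifs with hle
      · rcases lt_or_gt_of_ne hne with hlt | hlt
        · rw [ha, zero_mul]
          have : m * (j' + 1) ≤ m * j := Nat.mul_le_mul_left _ hlt
          rw [mul_add] at this
          omega
        · have : m * (j + 1) ≤ m * j' := Nat.mul_le_mul_left _ hlt
          rw [mul_add] at this
          omega
      · rfl
    · intro h
      exact absurd (Finset.mem_range.2 (by omega)) h
  · intro hi n
    refine Finset.sum_eq_zero fun j hj => ?_
    rw [Finset.mem_range] at hj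
    split_ifs with hle
    · by_cases h0 : a.coeff (n * p + (p - 1) - m * j) = 0
      · rw [h0, zero_mul]
      · exfalso
        have h1 := hi _ h0
        set i := n * p + (p - 1) - m * j with hidef
        have hp0 := hp.pos
        have h2 : i + 1 + s * j * p = j + (n + 1) * p := by
          have : s * j * p = m * j + j := by
            calc s * j * p = (s * p) * j := by ring
              _ = _ := by rw [← hm]; ring
          have h5 : (n + 1) * p = n * p + p := by ring
          omega
        have h3 := congrArg (· % p) h2
        simp only [Nat.add_mul_mod_self_right] at h3
        rw [h3, Nat.mod_eq_of_lt (by omega)] at h1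
        omega
    · rfl

theorem two_ne_zero_of_charP_odd {F : Type*} [Field F] {p r : ℕ} [Fact p.Prime] [CharP F p]
    (hr : p = 2 * r + 1) : (2 : F) ≠ 0 := by
  have : ((2 : ℕ) : F) ≠ 0 := by
    rw [Ne, CharP.cast_eq_zero_iff F p]
    intro h
    have := Nat.le_of_dvd two_pos h
    have := (Fact.out : p.Prime).two_le
    omega
  exact_mod_cast this

theorem natCast_ne_zero_of_succ_eq_mul {F : Type*} [Field F] {p s m : ℕ} [Fact p.Prime]
    [CharP F p] (hm : m + 1 = s * p) : (m : F) ≠ 0 := by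
  rw [Ne, CharP.cast_eq_zero_iff F p]
  intro h
  have h3 : p ∣ m + 1 := hm ▸ dvd_mul_left p s
  exact (Fact.out : p.Prime).one_lt.ne' (Nat.dvd_one.1 ((Nat.dvd_add_right h).1 h3))

/-- Each full period contributes the residues r + 1, ..., 2r; a tail of length t ≤ r contributes
none. -/
theorem Nat.count_lt_mod (r k t : ℕ) (ht : t ≤ r) :
    Nat.count (fun j => r < j % (2 * r + 1)) (k * (2 * r + 1) + t) = k * r := by
  induction k with
  | zero =>
    rw [zero_mul, zero_mul, zero_add, Nat.count_eq_card_filter_range, Finset.card_eq_zero,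
      Finset.filter_eq_empty_iff]
    intro j hj
    rw [Finset.mem_range] at hj
    rw [Nat.mod_eq_of_lt (by omega)]
    omega
  | succ k ih =>
    have h1 : (k + 1) * (2 * r + 1) + t = (2 * r + 1) + (k * (2 * r + 1) + t) := by ring
    rw [h1, Nat.count_add]
    simp only [Nat.add_mod_left]
    rw [ih]
    have h2 : Nat.count (fun j => r < j % (2 * r + 1)) (2 * r + 1) = r := by
      rw [Nat.count_eq_card_filter_range]
      have : (Finset.range (2 * r + 1)).filter (fun j => r < j % (2 * r + 1)) =
          Finset.Ico (r + 1) (2 * r + 1) := by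
        ext j
        simp only [Finset.mem_filter, Finset.mem_range, Finset.mem_Ico]
        constructor
        · rintro ⟨h3, h4⟩
          rw [Nat.mod_eq_of_lt h3] at h4
          omega
        · rintro ⟨h3, h4⟩
          rw [Nat.mod_eq_of_lt h4]
          omega
      rw [this, Nat.card_Ico]
      omega
    rw [h2]
    ring

theorem card_filter_lt_succ_mod {r k t g : ℕ} (ht : t ≤ r) (hg : g + 1 = k * (2 * r + 1) + t) :
    ((Finset.range g).filter fun i => r < (i + 1) % (2 * r + 1)).card = k * r := by
  -- The shift from i to i + 1 is harmless, as residue 0 is never counted.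
  rw [← Nat.count_lt_mod r k t ht, ← hg, Nat.count_succ', Nat.count_eq_card_filter_range]
  simp

/-! ### A monomial basis and the dimension. -/

namespace IsFunctionFieldOfSqEq

variable {F K : Type*} [Field F] [Field K] [Algebra F K] {x y : K}

local notation "d" => KaehlerDifferential.D F K

theorem mem_exactHolomorphicDifferentials_iff {m ε g p r s : ℕ}
    (H : IsFunctionFieldOfSqEq F K (X ^ m + 1) x y) [Fact p.Prime] [CharP F p]
    (hr : p = 2 * r + 1) (hm : m + 1 = s * p) (hε : ε ≤ 1) (hg : m + ε = 2 * g + 2)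
    (ω : KaehlerDifferential F K) :
    ω ∈ exactHolomorphicDifferentials F K ↔
      ∃ a : F[X], (∀ i, a.coeff i ≠ 0 → i < g ∧ r < (i + 1) % p) ∧
        ω = aeval x a • (y⁻¹ • d x) := by
  have h2 := two_ne_zero_of_charP_odd (F := F) hr
  have hmF := natCast_ne_zero_of_succ_eq_mul (F := F) hm
  have hsq := (separable_X_pow_add_one hmF).squarefree
  have hdeg : 0 < (X ^ m + 1 : F[X]).natDegree := by rw [natDegree_X_pow_add_one]; omega
  have hy := H.ne_zero hsq.ne_zero
  obtain ⟨δ, -, -, hω⟩ := H.exists_derivation h2 hsq hdeg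
  rw [exactHolomorphicDifferentials, Submodule.mem_inf]
  constructor
  · rintro ⟨hol, hex⟩
    obtain ⟨w, rfl⟩ := hω ω
    have hw : w • d x = (w * y) • (y⁻¹ • d x) := by
      rw [smul_smul, mul_inv_cancel_right₀ hy]
    rw [hw] at hol hex ⊢
    obtain ⟨a, ha, hwa⟩ := (H.smul_mem_holomorphicDifferentials_iff h2 hmF hε hg _).1 hol
    rw [hwa] at hex ⊢
    rw [H.smul_mem_exactDifferentials_iff h2 hsq hdeg hr,
      forall_coeff_mul_X_pow_add_one_pow_eq_zero_iff hr hm fun i hi => ha i (by omega)] at hex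
    refine ⟨a, fun i hi => ⟨?_, hex i hi⟩, rfl⟩
    by_contra! h
    exact hi (ha i h)
  · rintro ⟨a, ha, rfl⟩
    have ha' : ∀ i, g ≤ i → a.coeff i = 0 := by
      intro i hi
      by_contra h
      exact absurd (ha i h).1 (not_lt.2 hi)
    rw [H.smul_mem_holomorphicDifferentials_iff h2 hmF hε hg,
      H.smul_mem_exactDifferentials_iff h2 hsq hdeg hr,
      forall_coeff_mul_X_pow_add_one_pow_eq_zero_iff hr hm fun i hi => ha' i (by omega)]
    exact ⟨⟨a, ha', rfl⟩, fun i hi => (ha i hi).2⟩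

/-- The differentials x^i dx/y with i in the filtered set form a basis. Finiteness is recorded too,
since `Module.finrank` is 0 by default on infinite-dimensional spaces. -/
theorem finiteDimensional_and_aNumber_eq {m ε g p r s : ℕ}
    (H : IsFunctionFieldOfSqEq F K (X ^ m + 1) x y) [Fact p.Prime] [CharP F p]
    (hr : p = 2 * r + 1) (hm : m + 1 = s * p) (hε : ε ≤ 1) (hg : m + ε = 2 * g + 2) :
    FiniteDimensional F (exactHolomorphicDifferentials F K) ∧
      aNumber F K = ((Finset.range g).filter fun i => r < (i + 1) % p).card := by
  set S := (Finset.range g).filter fun i => r < (i + 1) % p with hS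
  let Φ : F[X] →ₗ[F] KaehlerDifferential F K :=
    (LinearMap.toSpanSingleton K _ (y⁻¹ • d x)).restrictScalars F ∘ₗ (aeval x).toLinearMap
  have hΦ : ∀ a, Φ a = aeval x a • (y⁻¹ • d x) := fun _ => rfl
  have hinj : LinearMap.ker Φ = ⊥ := by
    have h2 := two_ne_zero_of_charP_odd (F := F) hr
    have hmF := natCast_ne_zero_of_succ_eq_mul (F := F) hm
    have hsq := (separable_X_pow_add_one hmF).squarefree
    have hdeg : 0 < (X ^ m + 1 : F[X]).natDegree := by rw [natDegree_X_pow_add_one]; omega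
    rw [LinearMap.ker_eq_bot']
    intro a ha
    rw [hΦ, smul_smul, H.smul_D_eq_zero_iff h2 hsq hdeg,
      mul_eq_zero_iff_right (inv_ne_zero (H.ne_zero hsq.ne_zero))] at ha
    by_contra h0
    exact H.aeval_ne_zero h0 ha
  have hli : LinearIndependent F fun i : S => Φ (X ^ (i : ℕ)) := by
    have h1 : LinearIndependent F fun i : ℕ => (X ^ i : F[X]) := by
      simpa [X_pow_eq_monomial] using (basisMonomials F).linearIndependent
    exact (h1.comp (fun i : S => (i : ℕ)) Subtype.val_injective).map' Φ hinj
  have hspan : exactHolomorphicDifferentials F K =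
      Submodule.span F (Set.range fun i : S => Φ (X ^ (i : ℕ))) := by
    apply le_antisymm
    · intro ω hω
      obtain ⟨a, ha, rfl⟩ := (H.mem_exactHolomorphicDifferentials_iff hr hm hε hg ω).1 hω
      rw [← hΦ, a.as_sum_support_C_mul_X_pow, map_sum]
      refine Submodule.sum_mem _ fun i hi => ?_
      rw [← smul_eq_C_mul, map_smul]
      have hiS : i ∈ S := by
        obtain ⟨h3, h4⟩ := ha i (mem_support_iff.1 hi)
        exact Finset.mem_filter.2 ⟨Finset.mem_range.2 h3, h4⟩
      exact Submodule.smul_mem _ _ (Submodule.subset_span ⟨⟨i, hiS⟩, rfl⟩)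
    · rw [Submodule.span_le]
      rintro _ ⟨⟨i, hi⟩, rfl⟩
      refine (H.mem_exactHolomorphicDifferentials_iff hr hm hε hg _).2 ⟨X ^ i, ?_, rfl⟩
      intro j hj
      rw [coeff_X_pow] at hj
      obtain rfl : j = i := by
        by_contra h
        simp [h] at hj
      rw [hS, Finset.mem_filter, Finset.mem_range] at hi
      exact hi
  rw [aNumber, hspan]
  refine ⟨FiniteDimensional.span_of_finite F (Set.finite_range _), ?_⟩
  rw [finrank_span_eq_card hli, Fintype.card_coe]

end IsFunctionFieldOfSqEq

theorem theorem3p2 {p : ℕ} (hp : p.Prime) (hp2 : 2 < p)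
    {F : Type*} [Field F] [IsAlgClosed F] [CharP F p]
    {m s : ℕ} (hm : (m : ℤ) = (s : ℤ) * (p : ℤ) - 1)
    {K : Type*} [Field K] [Algebra F K] {x y : K}
    (hK : IsFunctionFieldOfSqEq F K (Polynomial.X ^ m + 1) x y) :
    FiniteDimensional F (exactHolomorphicDifferentials F K) ∧
    (∀ k : ℕ, s = 2 * k + 1 → (aNumber F K : ℚ) = (k : ℚ) * ((p : ℚ) - 1) / 2) ∧
    (∀ k : ℕ, 1 ≤ k → s = 2 * k → (aNumber F K : ℚ) = (k : ℚ) * ((p : ℚ) - 1) / 2) := by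
  have : Fact p.Prime := ⟨hp⟩
  have hm' : m + 1 = s * p := by zify; omega
  obtain ⟨r, hr⟩ : ∃ r, p = 2 * r + 1 := hp.odd_of_ne_two hp2.ne'
  have hs : 0 < s := Nat.pos_of_ne_zero (by rintro rfl; simp at hm')
  have hps : p ≤ s * p := Nat.le_mul_of_pos_left p hs
  obtain ⟨ε, g, hε, hg⟩ : ∃ ε g, ε ≤ 1 ∧ m + ε = 2 * g + 2 :=
    ⟨m % 2, (m - 1) / 2, by omega, by omega⟩
  obtain ⟨hfin, hdim⟩ := hK.finiteDimensional_and_aNumber_eq hr hm' hε hg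
  have key : ∀ k t : ℕ, t ≤ r → g + 1 = k * (2 * r + 1) + t →
      (aNumber F K : ℚ) = (k : ℚ) * ((p : ℚ) - 1) / 2 := by
    intro k t ht hgk
    subst hr
    rw [hdim, card_filter_lt_succ_mod ht hgk]
    push_cast
    ring
  refine ⟨hfin, ?_, ?_⟩
  · rintro k rfl
    -- Here m is even and g + 1 = m/2 = kp + r.
    apply key k r le_rfl
    have : (2 * k + 1) * p = 2 * (k * (2 * r + 1)) + (2 * r + 1) := by rw [hr]; ring
    omega
  · rintro k - rfl
    -- Here m is odd and g + 1 = (m + 1)/2 = kp.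
    apply key k 0 (Nat.zero_le _)
    have : 2 * k * p = 2 * (k * (2 * r + 1)) := by rw [hr]; ring
    omega
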